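/- By a uniform algebra on a compact Hausdorff space $\Omega$ we mean a subalgebra $A$ of $C(\Omega)$ (the continuous complex valued functions on $\Omega$, with the supremum norm) which contains the constants and separates the points of $\Omega$; norm-closedness is not required. Let $M_A$ denote its maximal ideal space, that is, the set of nonzero continuous multiplicative linear functionals on $A$ with the weak$^*$ topology. Each point of $\Omega$ is identified with the evaluation at that point, so that $\Omega\subset M_A$. For $\varphi:\Omega'\to M_A$ and $a\in A$, let $a\circ\varphi$ be the function $x\mapsto \varphi(x)(a)$ on $\Omega'$. For a linear subspace $E$ of $C(\Omega)$, let $Ch(E)$ be the set of all $x\in\Omega$ such that evaluation at $x$ is an extreme point of the closed unit ball of $E^*$, and let $\partial E$ be the closure of $Ch(E)$ in $\Omega$. For a strictly positive $f\in C(\Omega)$ let $Af=\{af: a\in A\}\subset C(\Omega)$, with the supremum norm and the $A$-module action by pointwise multiplication. Theorem. Let $A$ and $B$ be uniform algebras on compact Hausdorff spaces $\Omega_1$, $\Omega_2$ respectively, and let $f_1$, $f_2$ be strictly positive continuous functions on $\Omega_1$, $\Omega_2$ respectively. Suppose that $T:Af_1\to Bf_2$ is a surjective (complex) linear isometry. Then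 there is an invertible element $h$ of $B$ and a homeomorphism $\varphi$ of $\Omega_2$ onto a subset $\varphi(\Omega_2)$ of $M_A$ such that (i) the map $a\mapsto a\circ\varphi$ is an isometric algebra isomorphism of $A$ onto $B$; (ii) $\varphi(\partial B)=\partial A$ (as subsets of $M_A$); (iii) $\varphi(\partial(Bf_2))\subset\Omega_1$, and $\dfrac{f_1\circ\varphi}{f_2}=|h|$ on $\partial(Bf_2)$; and $$T(af_1)=(a\circ\varphi)\,h f_2\quad\text{on }\Omega_2,\qquad a\in A.$$ Moreover, if $\Omega_1=\Omega_2$ and $A=B$, then for $h$ and $\varphi$ as in this formula, $T$ is an $A$-module isometry (that is, $T(ag)=aT(g)$ for all $a\in A$, $g\in Af_1$) if and only if $\varphi$ is the identity map, i.e. $\varphi(x)$ is evaluation at $x$ for every $x\in\Omega_2$. -/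

import Mathlib

universe u v w

noncomputable section

namespace FunctionModule

variable {Ω : Type*} [TopologicalSpace Ω]

/-- A real continuous function, regarded as a complex valued one. -/
def toComplex (f : C(Ω, ℝ)) : C(Ω, ℂ) :=
  (⟨Complex.ofReal, Complex.continuous_ofReal⟩ : C(ℝ, ℂ)).comp f

/-- The space `A f = {a f : a ∈ A}`, as a complex linear subspace of `C(Ω)`. -/
def weighted (A : Subalgebra ℂ C(Ω, ℂ)) (f : C(Ω, ℝ)) : Submodule ℂ C(Ω, ℂ) :=
  (Subalgebra.toSubmodule A).map (LinearMap.mulRight ℂ (toComplex f))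

/-- The element `a f` of `A f`. -/
def weightedMk (A : Subalgebra ℂ C(Ω, ℂ)) (f : C(Ω, ℝ)) (a : A) : weighted A f :=
  ⟨(a : C(Ω, ℂ)) * toComplex f, ⟨a, a.2, rfl⟩⟩

/-- The module action of `A` on `A f`, by pointwise multiplication. -/
def weightedSMul (A : Subalgebra ℂ C(Ω, ℂ)) (f : C(Ω, ℝ)) (a : A) (g : weighted A f) :
    weighted A f :=
  ⟨(a : C(Ω, ℂ)) * (g : C(Ω, ℂ)), by
    obtain ⟨b, hb, hbg⟩ := g.2
    exact ⟨(a : C(Ω, ℂ)) * b, A.mul_mem a.2 hb, by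
      rw [← hbg]; simp [mul_assoc]⟩⟩

/-- The character of `A` given by evaluation at `x`; this is the canonical map of `Ω` into the
maximal ideal space `M_A` (nonzero continuous multiplicative functionals, weak* topology). -/
def evalChar (A : Subalgebra ℂ C(Ω, ℂ)) (x : Ω) : WeakDual.characterSpace ℂ A :=
  ⟨(⟨{ toFun := fun a => (a : C(Ω, ℂ)) x
       map_add' := fun _ _ => rfl
       map_smul' := fun _ _ => rfl },
      (continuous_eval_const x).comp continuous_subtype_val⟩ : A →L[ℂ] ℂ), by
    constructor
    · intro h
      have h1 := DFunLike.congr_fun h (1 : A)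
      change (1 : ℂ) = 0 at h1
      exact one_ne_zero h1
    · intro a b
      rfl⟩

variable [CompactSpace Ω]

/-- Evaluation at `x` as a bounded functional on the subspace `E` of `C(Ω)` (sup norm). -/
def evalFunctional (E : Submodule ℂ C(Ω, ℂ)) (x : Ω) : E →L[ℂ] ℂ :=
  (ContinuousMap.evalCLM ℂ x).comp E.subtypeL

/-- The Choquet boundary of a subspace `E` of `C(Ω)`: the points at which evaluation is an extreme
point of the closed unit ball of the dual space of `E`. -/
def choquetBoundary (E : Submodule ℂ C(Ω, ℂ)) : Set Ω :=
  {x | evalFunctional E x ∈ Set.extremePoints ℝ {F : E →L[ℂ] ℂ | ‖F‖ ≤ 1}}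

/-- The Shilov boundary of `E`: the closure of its Choquet boundary. -/
def shilovBoundary (E : Submodule ℂ C(Ω, ℂ)) : Set Ω :=
  closure (choquetBoundary E)

end FunctionModule

end

/-! An isometry transports extreme points of dual balls. By Milman's converse, those of the dual
ball of a function space are unimodular multiples of point evaluations at Choquet points. So for `x`
in the Choquet boundary of `B f₂` there are `|α| = 1` and `y` with `T(a f₁)(x) = α a(y) f₁(y)` for
all `a`.

Write `T(a f₁) = U(a) f₂`. This formula gives `U(ab) U(1) = U(a) U(b)` on the Choquet boundary,
which is norming by Krein-Milman, so the identity holds everywhere (`coefficientEquiv_mul`).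
Surjectivity makes `h = U(1)` invertible, and `Φ = U / h` is an algebra isomorphism, isometric
because bounded homomorphisms into function algebras are contractive. Then `φ` sends `x` to
evaluation at `x` composed with `Φ`. The boundary statements are read off at Choquet points and
passed to closures by compactness. -/

open Set Topology

/-! ### Milman's converse to Krein-Milman -/

section Convex

variable {E : Type*} [AddCommGroup E] [Module ℝ E] [TopologicalSpace E]
  [IsTopologicalAddGroup E] [ContinuousSMul ℝ E]

theorem IsCompact.convexJoin {s t : Set E} (hs : IsCompact s) (ht : IsCompact t) :
    IsCompact (convexJoin ℝ s t) := by
  have h : _root_.convexJoin ℝ s t =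
      (fun p : ℝ × E × E => (1 - p.1) • p.2.1 + p.1 • p.2.2) '' (Icc 0 1 ×ˢ s ×ˢ t) := by
    ext x
    simp only [mem_convexJoin, segment_eq_image, mem_image, mem_prod, Prod.exists]
    constructor
    · rintro ⟨a, ha, b, hb, θ, hθ, rfl⟩
      exact ⟨θ, a, b, ⟨hθ, ha, hb⟩, rfl⟩
    · rintro ⟨θ, a, b, ⟨hθ, ha, hb⟩, rfl⟩
      exact ⟨a, ha, b, hb, θ, hθ, rfl⟩
  rw [h]
  exact (isCompact_Icc.prod (hs.prod ht)).image (by fun_prop)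

theorem isCompact_convexHull_biUnion {ι : Type*} (t : Finset ι) {s : ι → Set E}
    (hs : ∀ i ∈ t, IsCompact (s i)) (hc : ∀ i ∈ t, Convex ℝ (s i)) :
    IsCompact (convexHull ℝ (⋃ i ∈ t, s i)) := by
  classical
  induction t using Finset.induction_on with
  | empty => simp
  | insert a t _ ih =>
    have ih' := ih (fun i hi => hs i (Finset.mem_insert_of_mem hi))
      (fun i hi => hc i (Finset.mem_insert_of_mem hi))
    have ha := Finset.mem_insert_self a t
    rw [Finset.set_biUnion_insert]
    rcases (s a).eq_empty_or_nonempty with h | h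
    · simpa [h] using ih'
    rcases (⋃ i ∈ t, s i).eq_empty_or_nonempty with h' | h'
    · rw [h', union_empty, (hc a ha).convexHull_eq]
      exact hs a ha
    · rw [convexHull_union h h', (hc a ha).convexHull_eq]
      exact (hs a ha).convexJoin ih'

/-- **Milman's converse** to the Krein-Milman theorem: the extreme points of a compact closed
convex hull of a compact set lie in that set. -/
theorem IsCompact.extremePoints_closure_convexHull_subset [T2Space E] [LocallyConvexSpace ℝ E]
    {K : Set E} (hK : IsCompact K) (hC : IsCompact (closure (convexHull ℝ K))) :
    (closure (convexHull ℝ K)).extremePoints ℝ ⊆ K := by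
  intro x hx
  by_contra hxK
  -- Each point of `K` has a closed half-space neighbourhood missing `x`; finitely many of them
  -- cover `K`.
  have hsep : ∀ p : E, ∃ V : Set E, p ∈ K → V ∈ 𝓝 p ∧ IsClosed V ∧ Convex ℝ V ∧ x ∉ V := by
    intro p
    by_cases hp : p ∈ K
    · have hne : p ≠ x := fun h => hxK (h ▸ hp)
      obtain ⟨l, hl⟩ := geometric_hahn_banach_point_point hne
      refine ⟨{q | l q ≤ (l p + l x) / 2}, fun _ => ⟨?_, ?_, ?_, ?_⟩⟩
      · filter_upwards [(isOpen_lt l.continuous continuous_const).mem_nhds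
          (show l p < (l p + l x) / 2 by linarith)] with q hq
        exact le_of_lt hq
      · exact isClosed_le l.continuous continuous_const
      · exact convex_halfSpace_le l.toLinearMap.isLinear _
      · rw [mem_ofPred_eq, not_le]
        linarith
    · exact ⟨∅, fun h => (hp h).elim⟩
  choose V hV using hsep
  obtain ⟨t, htK, ht⟩ := hK.elim_nhds_subcover V fun p hp => (hV p hp).1
  have hsubV : ∀ p ∈ t, closure (convexHull ℝ (K ∩ V p)) ⊆ V p := fun p hp =>
    closure_minimal (convexHull_min inter_subset_right (hV p (htK p hp)).2.2.1)
      (hV p (htK p hp)).2.1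
  have hsubC : ∀ p, closure (convexHull ℝ (K ∩ V p)) ⊆ closure (convexHull ℝ K) := fun p =>
    closure_mono (convexHull_mono inter_subset_left)
  have hcomp : IsCompact (convexHull ℝ (⋃ p ∈ t, closure (convexHull ℝ (K ∩ V p)))) :=
    isCompact_convexHull_biUnion t (fun p _ => hC.of_isClosed_subset isClosed_closure (hsubC p))
      fun p _ => (convex_convexHull ℝ _).closure
  have heq : convexHull ℝ (⋃ p ∈ t, closure (convexHull ℝ (K ∩ V p))) =
      -- The hull of finitely many compact convex pieces is already compact, so no closure is needed
      -- and an extreme point must lie in one piece.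
      closure (convexHull ℝ K) := by
    apply Subset.antisymm
    · exact convexHull_min (iUnion₂_subset fun p _ => hsubC p) (convex_convexHull ℝ _).closure
    · refine closure_minimal (convexHull_min (fun y hy => subset_convexHull ℝ _ ?_)
        (convex_convexHull ℝ _)) hcomp.isClosed
      obtain ⟨p, hp, hyp⟩ := mem_iUnion₂.1 (ht hy)
      exact mem_iUnion₂.2 ⟨p, hp, subset_closure (subset_convexHull ℝ _ ⟨hy, hyp⟩)⟩
  rw [← heq] at hx
  obtain ⟨p, hp, hxp⟩ := mem_iUnion₂.1 (extremePoints_convexHull_subset hx)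
  exact (hV p (htK p hp)).2.2.2 (hsubV p hp hxp)

end Convex

/-! ### Extreme points of the dual ball -/

section Dual

variable {X Y : Type*} [NormedAddCommGroup X] [NormedSpace ℂ X] [NormedAddCommGroup Y]
  [NormedSpace ℂ Y]

instance WeakDual.instIsScalarTowerRealComplex : IsScalarTower ℝ ℂ (WeakDual ℂ X) :=
  inferInstanceAs (IsScalarTower ℝ ℂ (X →L[ℂ] ℂ))

instance WeakDual.instLocallyConvexSpaceRealComplex : LocallyConvexSpace ℝ (WeakDual ℂ X) :=
  (topDualPairing ℂ X).weakBilin_withSeminorms.toLocallyConvexSpace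

theorem WeakDual.exists_eq_eval (l : StrongDual ℂ (WeakDual ℂ X)) :
    ∃ f : X, ∀ F : WeakDual ℂ X, l F = F f := by
  obtain ⟨f, hf⟩ := LinearMap.dualEmbedding_surjective (topDualPairing ℂ X) l
  exact ⟨f, fun F => (DFunLike.congr_fun hf F).symm⟩

theorem LinearEquiv.mem_extremePoints_unitBall
    (e : X ≃ₗ[ℂ] Y) (he : ∀ F, ‖e F‖ = ‖F‖) {F : X}
    (hF : F ∈ extremePoints ℝ {F : X | ‖F‖ ≤ 1}) :
    e F ∈ extremePoints ℝ {F : Y | ‖F‖ ≤ 1} := by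
  have h : (e.restrictScalars ℝ) '' {F : X | ‖F‖ ≤ 1} = {F : Y | ‖F‖ ≤ 1} := by
    ext G
    constructor
    · rintro ⟨F, hF, rfl⟩
      exact (he F).le.trans hF
    · intro hG
      refine ⟨e.symm G, ?_, e.apply_symm_apply G⟩
      change ‖e.symm G‖ ≤ 1
      rw [← he, e.apply_symm_apply]
      exact hG
  rw [← h, ← image_extremePoints]
  exact ⟨F, hF, rfl⟩

theorem LinearIsometryEquiv.comp_mem_extremePoints_dualBall (T : X ≃ₗᵢ[ℂ] Y) {G : Y →L[ℂ] ℂ}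
    (hG : G ∈ extremePoints ℝ {G : Y →L[ℂ] ℂ | ‖G‖ ≤ 1}) :
    G.comp (T : X →L[ℂ] Y) ∈ extremePoints ℝ {F : X →L[ℂ] ℂ | ‖F‖ ≤ 1} :=
  (T.symm.toContinuousLinearEquiv.arrowCongr
    (ContinuousLinearEquiv.refl ℂ ℂ)).toLinearEquiv.mem_extremePoints_unitBall
      (fun F => F.opNorm_comp_linearIsometryEquiv T) hG

variable (X) in
/-- The closed unit ball of the dual of `X`, as a subset of the weak-star dual. -/
def WeakDual.unitBall : Set (WeakDual ℂ X) := {F | ‖WeakDual.toStrongDual F‖ ≤ 1}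

variable (X) in
theorem WeakDual.isCompact_unitBall : IsCompact (WeakDual.unitBall X) := by
  have h := WeakDual.isCompact_closedBall (𝕜 := ℂ) (E := X) 0 1
  convert! h using 1
  ext F
  simp [WeakDual.unitBall]

variable (X) in
theorem WeakDual.convex_unitBall : Convex ℝ (WeakDual.unitBall X) := by
  have h : Convex ℝ (Metric.closedBall (0 : X →L[ℂ] ℂ) 1) := convex_closedBall _ _
  have h2 : Metric.closedBall (0 : X →L[ℂ] ℂ) 1 = {F | ‖F‖ ≤ 1} := by ext; simp
  rw [h2] at h
  exact h

variable {Ω : Type*} {ev : Ω → X →L[ℂ] ℂ}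

/-- The unimodular multiples of the members of a family of functionals. -/
def WeakDual.unimodularMultiples (ev : Ω → X →L[ℂ] ℂ) : Set (WeakDual ℂ X) :=
  (fun p : ℂ × Ω => StrongDual.toWeakDual (p.1 • ev p.2)) '' (Metric.sphere 0 1 ×ˢ univ)

theorem WeakDual.isCompact_unimodularMultiples [TopologicalSpace Ω] [CompactSpace Ω]
    (hc : ∀ f, Continuous fun x => ev x f) :
    IsCompact (unimodularMultiples ev) := by
  refine ((isCompact_sphere (0 : ℂ) 1).prod isCompact_univ).image ?_
  refine WeakDual.continuous_of_continuous_eval fun f => ?_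
  exact continuous_fst.mul ((hc f).comp continuous_snd)

/-- Hahn-Banach: weak-star continuous functionals are evaluations at some `f`, and a functional `F`
separated from the hull would have `Re F(f)` exceeding a bound for every `|ev x f|`, hence exceeding
`‖f‖`, as the family is norming. -/
theorem WeakDual.closure_convexHull_unimodularMultiples (h1 : ∀ x, ‖ev x‖ ≤ 1)
    (hn : ∀ f c, (∀ x, ‖ev x f‖ ≤ c) → ‖f‖ ≤ c) :
    closure (convexHull ℝ (unimodularMultiples ev)) = unitBall X := by
  apply Subset.antisymm
  · refine closure_minimal (convexHull_min ?_ (convex_unitBall X)) (isCompact_unitBall X).isClosed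
    rintro _ ⟨⟨α, x⟩, ⟨hα, -⟩, rfl⟩
    change ‖α • ev x‖ ≤ 1
    rw [norm_smul, mem_sphere_zero_iff_norm.1 hα, one_mul]
    exact h1 x
  · intro F hF
    by_contra hFK
    have hcl := fun h => Convex.closure (𝕜 := ℝ) (E := WeakDual ℂ X)
      (s := convexHull ℝ (unimodularMultiples ev)) h
    have hsep := fun h => RCLike.geometric_hahn_banach_closed_point (𝕜 := ℂ)
      (E := WeakDual ℂ X) (s := closure (convexHull ℝ (unimodularMultiples ev))) (x := F) h
    obtain ⟨l, u, hu, hlu⟩ := hsep (hcl (convex_convexHull ℝ _)) isClosed_closure hFK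
    obtain ⟨f, hf⟩ := WeakDual.exists_eq_eval l
    have hx : ∀ x, ‖ev x f‖ ≤ u := by
      intro x
      obtain ⟨α, hα, hαf⟩ : ∃ α : ℂ, ‖α‖ = 1 ∧ ‖ev x f‖ = α * ev x f :=
        RCLike.exists_norm_eq_mul_self _
      have h := hu _ (subset_closure (subset_convexHull ℝ _
        ⟨(α, x), ⟨mem_sphere_zero_iff_norm.2 hα, mem_univ x⟩, rfl⟩))
      rw [hf] at h
      change (α * ev x f).re < u at h
      rw [← hαf, Complex.ofReal_re] at h
      exact h.le
    have hfu : ‖f‖ ≤ u := hn f u hx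
    have h1 : ‖F f‖ ≤ 1 * ‖f‖ := (WeakDual.toStrongDual F).le_of_opNorm_le hF f
    rw [hf] at hlu
    have h2 := Complex.re_le_norm (F f)
    change u < (F f).re at hlu
    linarith

theorem exists_eq_smul_of_mem_extremePoints_dualBall [TopologicalSpace Ω] [CompactSpace Ω]
    (hc : ∀ f, Continuous fun x => ev x f)
    (h1 : ∀ x, ‖ev x‖ ≤ 1) (hn : ∀ f c, (∀ x, ‖ev x f‖ ≤ c) → ‖f‖ ≤ c) {F : X →L[ℂ] ℂ}
    (hF : F ∈ extremePoints ℝ {F : X →L[ℂ] ℂ | ‖F‖ ≤ 1}) :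
    ∃ α : ℂ, ‖α‖ = 1 ∧ ∃ x, ev x ∈ extremePoints ℝ {F : X →L[ℂ] ℂ | ‖F‖ ≤ 1} ∧
      F = α • ev x := by
  have hF' : StrongDual.toWeakDual F ∈ (WeakDual.unitBall X).extremePoints ℝ := hF
  have hcl := WeakDual.closure_convexHull_unimodularMultiples h1 hn
  rw [← hcl] at hF'
  obtain ⟨⟨α, x⟩, ⟨hα, -⟩, h⟩ :=
    (WeakDual.isCompact_unimodularMultiples hc).extremePoints_closure_convexHull_subset
      (by rw [hcl]; exact WeakDual.isCompact_unitBall X) hF'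
  have hα1 : ‖α‖ = 1 := mem_sphere_zero_iff_norm.1 hα
  have hα0 : α ≠ 0 := by
    rintro rfl
    simp at hα1
  have hFx : α • ev x = F := h
  refine ⟨α, hα1, x, ?_, hFx.symm⟩
  -- Rotation by `α⁻¹` preserves the ball, so `ev x = α⁻¹ F` is extreme as well.
  have key := (LinearEquiv.smulOfNeZero ℂ (X →L[ℂ] ℂ) α⁻¹
    (inv_ne_zero hα0)).mem_extremePoints_unitBall
      (fun G => by simp [norm_smul, hα1]) hF
  rw [← hFx] at key
  simpa [smul_smul, hα0] using! key

/-- Krein-Milman: the half-space `Re G(f) ≤ c` contains the extreme points, hence the whole ball,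
including a functional norming `f`. -/
theorem norm_le_of_forall_mem_extremePoints_dualBall {f : X} {c : ℝ}
    (h : ∀ F ∈ extremePoints ℝ {F : X →L[ℂ] ℂ | ‖F‖ ≤ 1}, ‖F f‖ ≤ c) : ‖f‖ ≤ c := by
  obtain ⟨F, hF, hFf⟩ := exists_dual_vector'' ℂ f
  have hball : WeakDual.unitBall X ⊆ {G : WeakDual ℂ X | (G f).re ≤ c} := by
    have hkm := closure_convexHull_extremePoints (E := WeakDual ℂ X)
      (WeakDual.isCompact_unitBall X)
    rw [← hkm (WeakDual.convex_unitBall X)]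
    refine closure_minimal (convexHull_min ?_ ?_) ?_
    · intro G hG
      exact (Complex.re_le_norm _).trans (h (WeakDual.toStrongDual G) hG)
    · intro G hG H hH a b ha hb hab
      change (a • G f + b • H f : ℂ).re ≤ c
      have hG' : (G f).re ≤ c := hG
      have hH' : (H f).re ≤ c := hH
      simp only [Complex.add_re, Complex.real_smul, Complex.re_ofReal_mul]
      calc a * (G f).re + b * (H f).re ≤ a * c + b * c := by gcongr
        _ = c := by rw [← add_mul, hab, one_mul]
    · exact isClosed_le (Complex.continuous_re.comp (WeakDual.eval_continuous _)) continuous_const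
  have h1 : (F f).re ≤ c := hball (show StrongDual.toWeakDual F ∈ WeakDual.unitBall X from hF)
  rw [hFf] at h1
  simpa using! h1

end Dual

/-! ### Choquet boundaries of function spaces -/

namespace FunctionModule

variable {Ω : Type*} [TopologicalSpace Ω] [CompactSpace Ω] (E : Submodule ℂ C(Ω, ℂ))

/-- Evaluation at a point, as an element of the strong dual of the normed space `E`. -/
noncomputable def strongEval (x : Ω) : StrongDual ℂ E :=
  LinearMap.mkContinuous
    { toFun := fun f : E => (f : C(Ω, ℂ)) x
      map_add' := fun _ _ => rfl
      map_smul' := fun _ _ => rfl } 1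
    fun f => by
      rw [one_mul]
      exact (f : C(Ω, ℂ)).norm_coe_le_norm x

theorem norm_strongEval_le (x : Ω) : ‖strongEval E x‖ ≤ 1 :=
  LinearMap.mkContinuous_norm_le _ zero_le_one _

theorem mem_choquetBoundary_iff {x : Ω} : x ∈ choquetBoundary E ↔
    strongEval E x ∈ extremePoints ℝ {F : StrongDual ℂ E | ‖F‖ ≤ 1} :=
  Iff.rfl

theorem exists_eq_smul_eval_of_mem_extremePoints [Nonempty Ω] {F : StrongDual ℂ E}
    (hF : F ∈ extremePoints ℝ {F : StrongDual ℂ E | ‖F‖ ≤ 1}) :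
    ∃ α : ℂ, ‖α‖ = 1 ∧ ∃ x ∈ choquetBoundary E, ∀ f : E, F f = α * (f : C(Ω, ℂ)) x := by
  obtain ⟨α, hα, x, hx, rfl⟩ := exists_eq_smul_of_mem_extremePoints_dualBall
    (fun f : E => (f : C(Ω, ℂ)).continuous) (norm_strongEval_le E)
    (fun f c h => (ContinuousMap.norm_le_of_nonempty _).2 h) hF
  exact ⟨α, hα, x, hx, fun f => rfl⟩

theorem norm_le_of_forall_choquetBoundary {f : C(Ω, ℂ)} (hf : f ∈ E) {c : ℝ} (hc : 0 ≤ c)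
    (h : ∀ x ∈ choquetBoundary E, ‖f x‖ ≤ c) : ‖f‖ ≤ c := by
  rcases isEmpty_or_nonempty Ω with hΩ | hΩ
  · rw [Subsingleton.elim f 0, norm_zero]
    exact hc
  refine norm_le_of_forall_mem_extremePoints_dualBall (f := (⟨f, hf⟩ : E)) fun F hF => ?_
  obtain ⟨α, hα, x, hx, hFx⟩ := exists_eq_smul_eval_of_mem_extremePoints E hF
  rw [hFx, norm_mul, hα, one_mul]
  exact h x hx

theorem eq_zero_of_forall_choquetBoundary {f : C(Ω, ℂ)} (hf : f ∈ E)
    (h : ∀ x ∈ choquetBoundary E, f x = 0) : f = 0 :=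
  norm_le_zero_iff.1 (norm_le_of_forall_choquetBoundary E hf le_rfl fun x hx => by simp [h x hx])

variable {E}

theorem exists_choquetBoundary_of_linearIsometryEquiv {Ω' : Type*} [TopologicalSpace Ω']
    [CompactSpace Ω'] [Nonempty Ω] {E' : Submodule ℂ C(Ω', ℂ)} (T : E ≃ₗᵢ[ℂ] E') {x : Ω'}
    (hx : x ∈ choquetBoundary E') :
    ∃ α : ℂ, ‖α‖ = 1 ∧ ∃ y ∈ choquetBoundary E, ∀ f : E,
      (T f : C(Ω', ℂ)) x = α * (f : C(Ω, ℂ)) y :=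
  exists_eq_smul_eval_of_mem_extremePoints E
    (T.comp_mem_extremePoints_dualBall ((mem_choquetBoundary_iff E').1 hx))

end FunctionModule

/-! ### From the twisted product identity to an algebra isomorphism -/

theorem LinearEquiv.exists_algEquiv_of_map_mul_mul_map_one {R A B : Type*} [CommSemiring R]
    [CommRing A] [Algebra R A] [CommRing B] [Algebra R B] (U : A ≃ₗ[R] B)
    (hU : ∀ a b, U (a * b) * U 1 = U a * U b) :
    ∃ (c : B) (Φ : A ≃ₐ[R] B), c * U 1 = 1 ∧ ∀ a, Φ a = U a * c := by
  -- Taking `a = b = k` in `hU` shows that `U (k * k)` inverts `U 1`.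
  set k := U.symm 1
  have hUk : U k = 1 := U.apply_symm_apply 1
  set c := U (k * k) with hc
  have hc1 : c * U 1 = 1 := by rw [hc, hU, hUk, one_mul]
  let Ψ : A →ₐ[R] B := AlgHom.ofLinearMap ((LinearMap.mulRight R c).comp U.toLinearMap)
    (by simpa [mul_comm] using hc1) fun a b => by
      change U (a * b) * c = U a * c * (U b * c)
      linear_combination c * c * hU a b - U (a * b) * c * hc1
  have hΨ : ∀ a, Ψ a = U a * c := fun a => rfl
  have hbij : Function.Bijective Ψ := by
    constructor
    · intro a b hab
      apply U.injective
      rw [← mul_one (U a), ← mul_one (U b), ← hc1, ← mul_assoc, ← mul_assoc, ← hΨ, ← hΨ, hab]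
    · intro b
      refine ⟨U.symm (b * U 1), ?_⟩
      rw [hΨ, U.apply_symm_apply, mul_assoc, mul_comm _ c, hc1, mul_one]
  exact ⟨c, AlgEquiv.ofBijective Ψ hbij, hc1, hΨ⟩

/-! ### Isometries between weighted spaces -/

namespace FunctionModule

section Weighted

variable {Ω : Type*} [TopologicalSpace Ω] (A : Subalgebra ℂ C(Ω, ℂ)) {f : C(Ω, ℝ)}

theorem weightedMk_apply (f : C(Ω, ℝ)) (a : A) (x : Ω) :
    (weightedMk A f a : C(Ω, ℂ)) x = (a : C(Ω, ℂ)) x * (f x : ℂ) :=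
  rfl

theorem weightedMk_surjective : Function.Surjective (weightedMk A f) := by
  rintro ⟨_, a, ha, rfl⟩
  exact ⟨⟨a, ha⟩, rfl⟩

theorem weightedMk_injective (hf : ∀ x, 0 < f x) : Function.Injective (weightedMk A f) := by
  intro a b hab
  ext x
  have h := congrArg (fun g : weighted A f => (g : C(Ω, ℂ)) x) hab
  exact mul_right_cancel₀ (Complex.ofReal_ne_zero.2 (hf x).ne') h

/-- Multiplication by a strictly positive function `f`, as a linear bijection of `A` onto `A f`. -/
noncomputable def weightedEquiv (hf : ∀ x, 0 < f x) : A ≃ₗ[ℂ] weighted A f :=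
  LinearEquiv.ofBijective
    { toFun := weightedMk A f
      map_add' := fun a b => Subtype.ext (add_mul (a : C(Ω, ℂ)) b (toComplex f))
      map_smul' := fun c a => Subtype.ext (by exact smul_mul_assoc c (a : C(Ω, ℂ)) (toComplex f)) }
    ⟨weightedMk_injective A hf, weightedMk_surjective A⟩

variable [CompactSpace Ω]

theorem norm_weightedMk_le (f : C(Ω, ℝ)) (a : A) :
    ‖weightedMk A f a‖ ≤ ‖a‖ * ‖toComplex f‖ :=
  norm_mul_le (a : C(Ω, ℂ)) (toComplex f)

theorem exists_norm_le_mul_norm_weightedMk (hf : ∀ x, 0 < f x) :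
    ∃ C, ∀ a : A, ‖a‖ ≤ C * ‖weightedMk A f a‖ := by
  refine ⟨‖toComplex ⟨fun x => (f x)⁻¹, f.continuous.inv₀ fun x => (hf x).ne'⟩‖, fun a => ?_⟩
  have h : (a : C(Ω, ℂ)) = toComplex ⟨fun x => (f x)⁻¹, f.continuous.inv₀ fun x => (hf x).ne'⟩ *
      (weightedMk A f a : C(Ω, ℂ)) := by
    ext x
    have hx : (f x : ℂ) ≠ 0 := Complex.ofReal_ne_zero.2 (hf x).ne'
    change (a : C(Ω, ℂ)) x = (((f x)⁻¹ : ℝ) : ℂ) * ((a : C(Ω, ℂ)) x * (f x : ℂ))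
    rw [Complex.ofReal_inv]
    field_simp
  calc ‖a‖ = ‖(a : C(Ω, ℂ))‖ := rfl
    _ ≤ _ := by
      conv_lhs => rw [h]
      exact norm_mul_le _ _

end Weighted

variable {Ω₁ Ω₂ : Type*} [TopologicalSpace Ω₁] [TopologicalSpace Ω₂]

theorem nonempty_of_linearEquiv {A : Subalgebra ℂ C(Ω₁, ℂ)} {B : Subalgebra ℂ C(Ω₂, ℂ)}
    (U : A ≃ₗ[ℂ] B) (x : Ω₂) : Nonempty Ω₁ := by
  by_contra h
  rw [not_nonempty_iff] at h
  have h1 : (U.symm 1 : A) = U.symm 0 := by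
    ext y
    exact h.elim y
  have h2 := congrArg (fun b : B => (b : C(Ω₂, ℂ)) x) (U.symm.injective h1)
  exact one_ne_zero (α := ℂ) h2

variable [CompactSpace Ω₁] [CompactSpace Ω₂]
  {A : Subalgebra ℂ C(Ω₁, ℂ)} {B : Subalgebra ℂ C(Ω₂, ℂ)} {f₁ : C(Ω₁, ℝ)} {f₂ : C(Ω₂, ℝ)}

/-- The linear bijection of `A` onto `B` induced by an isometry of `A f₁` onto `B f₂`. -/
noncomputable def coefficientEquiv (hf₁ : ∀ x, 0 < f₁ x) (hf₂ : ∀ x, 0 < f₂ x)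
    (T : weighted A f₁ ≃ₗᵢ[ℂ] weighted B f₂) : A ≃ₗ[ℂ] B :=
  (weightedEquiv A hf₁).trans (T.toLinearEquiv.trans (weightedEquiv B hf₂).symm)

section CoefficientEquiv

variable (hf₁ : ∀ x, 0 < f₁ x) (hf₂ : ∀ x, 0 < f₂ x) (T : weighted A f₁ ≃ₗᵢ[ℂ] weighted B f₂)

theorem weightedMk_coefficientEquiv (a : A) :
    weightedMk B f₂ (coefficientEquiv hf₁ hf₂ T a) = T (weightedMk A f₁ a) :=
  (weightedEquiv B hf₂).apply_symm_apply _

theorem exists_norm_coefficientEquiv_le : ∃ C, ∀ a, ‖coefficientEquiv hf₁ hf₂ T a‖ ≤ C * ‖a‖ := by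
  obtain ⟨C, hC⟩ := exists_norm_le_mul_norm_weightedMk B hf₂
  refine ⟨max C 0 * ‖toComplex f₁‖, fun a => ?_⟩
  calc ‖coefficientEquiv hf₁ hf₂ T a‖ ≤ C * ‖weightedMk B f₂ (coefficientEquiv hf₁ hf₂ T a)‖ :=
        hC _
    _ = C * ‖weightedMk A f₁ a‖ := by rw [weightedMk_coefficientEquiv, T.norm_map]
    _ ≤ max C 0 * (‖a‖ * ‖toComplex f₁‖) :=
        mul_le_mul (le_max_left _ _) (norm_weightedMk_le A f₁ a) (norm_nonneg _)
          (le_max_right _ _)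
    _ = max C 0 * ‖toComplex f₁‖ * ‖a‖ := by ring

theorem exists_coefficientEquiv_eq {x : Ω₂} (hx : x ∈ choquetBoundary (weighted B f₂)) :
    ∃ α : ℂ, ‖α‖ = 1 ∧ ∃ y, ∀ a, (coefficientEquiv hf₁ hf₂ T a : C(Ω₂, ℂ)) x * (f₂ x : ℂ) =
      α * ((a : C(Ω₁, ℂ)) y * (f₁ y : ℂ)) := by
  have := nonempty_of_linearEquiv (coefficientEquiv hf₁ hf₂ T) x
  obtain ⟨α, hα, y, -, h⟩ := exists_choquetBoundary_of_linearIsometryEquiv T hx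
  refine ⟨α, hα, y, fun a => ?_⟩
  rw [← weightedMk_apply, weightedMk_coefficientEquiv, h, weightedMk_apply]

/-- At a Choquet point both sides, multiplied by `f₂(x)²`, equal `α² a(y) b(y) f₁(y)²`. The
difference times `f₂` lies in `B f₂`, so it vanishes once it does so on that boundary. -/
theorem coefficientEquiv_mul (a b : A) :
    coefficientEquiv hf₁ hf₂ T (a * b) * coefficientEquiv hf₁ hf₂ T 1 =
      coefficientEquiv hf₁ hf₂ T a * coefficientEquiv hf₁ hf₂ T b := by
  set U := coefficientEquiv hf₁ hf₂ T with hU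
  rw [← sub_eq_zero]
  apply weightedMk_injective B hf₂
  refine Subtype.ext (Eq.trans ?_ (zero_mul (toComplex f₂)).symm)
  refine eq_zero_of_forall_choquetBoundary _ (Subtype.property _) fun x hx => ?_
  obtain ⟨α, -, y, h⟩ := exists_coefficientEquiv_eq hf₁ hf₂ T hx
  have hx0 : (f₂ x : ℂ) ≠ 0 := Complex.ofReal_ne_zero.2 (hf₂ x).ne'
  have h1 := h 1
  have ha := h a
  have hb := h b
  have hab := h (a * b)
  change _ = α * (1 * _) at h1
  change _ = α * ((a : C(Ω₁, ℂ)) y * (b : C(Ω₁, ℂ)) y * _) at hab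
  rw [← hU] at h1 ha hb hab
  change ((U (a * b) : C(Ω₂, ℂ)) x * (U 1 : C(Ω₂, ℂ)) x -
    (U a : C(Ω₂, ℂ)) x * (U b : C(Ω₂, ℂ)) x) * (f₂ x : ℂ) = 0
  apply mul_right_cancel₀ hx0
  linear_combination (U 1 : C(Ω₂, ℂ)) x * (f₂ x : ℂ) * hab +
    α * ((a : C(Ω₁, ℂ)) y * (b : C(Ω₁, ℂ)) y * (f₁ y : ℂ)) * h1 -
    (U b : C(Ω₂, ℂ)) x * (f₂ x : ℂ) * ha - α * ((a : C(Ω₁, ℂ)) y * (f₁ y : ℂ)) * hb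

end CoefficientEquiv

/-- Since `|Φ(a)(x)|^n = |Φ(a^n)(x)| ≤ C ‖a‖^n`, taking `n`-th roots removes the constant. -/
theorem norm_algEquiv_apply_le (Φ : A ≃ₐ[ℂ] B) {C : ℝ} (hC : ∀ a, ‖Φ a‖ ≤ C * ‖a‖) (a : A) :
    ‖Φ a‖ ≤ ‖a‖ := by
  refine (ContinuousMap.norm_le _ (norm_nonneg a)).2 fun x => ?_
  let e : C(Ω₂, ℂ) →+* ℂ := ContinuousMap.evalAlgHom ℂ ℂ x
  refine contraction_of_isPowMul (f := (e.comp B.val.toRingHom).comp Φ.toRingEquiv.toRingHom)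
    (fun z n _ => norm_pow z n) ⟨max C 1, by positivity, fun b => ?_⟩ a
  calc ‖(Φ b : C(Ω₂, ℂ)) x‖ ≤ ‖Φ b‖ := (Φ b : C(Ω₂, ℂ)).norm_coe_le_norm x
    _ ≤ C * ‖b‖ := hC b
    _ ≤ max C 1 * ‖b‖ := by gcongr; exact le_max_left _ _

theorem exists_algEquiv_of_linearIsometryEquiv (hf₁ : ∀ x, 0 < f₁ x) (hf₂ : ∀ x, 0 < f₂ x)
    (T : weighted A f₁ ≃ₗᵢ[ℂ] weighted B f₂) :
    ∃ (h : B) (Φ : A ≃ₐ[ℂ] B), IsUnit h ∧ (∀ a, ‖Φ a‖ = ‖a‖) ∧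
      ∀ a x, (T (weightedMk A f₁ a) : C(Ω₂, ℂ)) x =
        (Φ a : C(Ω₂, ℂ)) x * (h : C(Ω₂, ℂ)) x * (f₂ x : ℂ) := by
  set U := coefficientEquiv hf₁ hf₂ T with hU
  have hmul : ∀ a b, U (a * b) * U 1 = U a * U b := coefficientEquiv_mul hf₁ hf₂ T
  obtain ⟨c, Φ, hc1, hΦc⟩ := U.exists_algEquiv_of_map_mul_mul_map_one hmul
  have hΦ : ∀ a, Φ a * U 1 = U a := fun a => by rw [hΦc, mul_assoc, hc1, mul_one]
  have hle : ∀ a, ‖Φ a‖ ≤ ‖a‖ := by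
    obtain ⟨C, hC⟩ := exists_norm_coefficientEquiv_le hf₁ hf₂ T
    refine norm_algEquiv_apply_le Φ (C := C * ‖c‖) fun a => ?_
    rw [hΦc]
    calc ‖U a * c‖ ≤ ‖U a‖ * ‖c‖ := norm_mul_le _ _
      _ ≤ C * ‖a‖ * ‖c‖ := by gcongr; exact hC a
      _ = C * ‖c‖ * ‖a‖ := by ring
  have hge : ∀ b, ‖Φ.symm b‖ ≤ ‖b‖ := by
    obtain ⟨C, hC⟩ := exists_norm_coefficientEquiv_le hf₂ hf₁ T.symm
    refine norm_algEquiv_apply_le Φ.symm (C := max C 0 * ‖U 1‖) fun b => ?_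
    have h1 : Φ.symm b = U.symm (b * U 1) := by
      apply U.injective
      rw [U.apply_symm_apply, ← hΦ, Φ.apply_symm_apply]
    calc ‖Φ.symm b‖ = ‖U.symm (b * U 1)‖ := by rw [h1]
      -- The coefficient map of `T.symm` is `U.symm` by definition.
      _ ≤ C * ‖b * U 1‖ := hC _
      _ ≤ max C 0 * (‖b‖ * ‖U 1‖) := mul_le_mul (le_max_left _ _) (norm_mul_le _ _)
          (norm_nonneg _) (le_max_right _ _)
      _ = max C 0 * ‖U 1‖ * ‖b‖ := by ring
  refine ⟨U 1, Φ, IsUnit.of_mul_eq_one c (by rw [mul_comm, hc1]), fun a => ?_, fun a x => ?_⟩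
  · refine le_antisymm (hle a) ?_
    calc ‖a‖ = ‖Φ.symm (Φ a)‖ := by rw [Φ.symm_apply_apply]
      _ ≤ ‖Φ a‖ := hge _
  · rw [← weightedMk_coefficientEquiv hf₁ hf₂, weightedMk_apply, ← hU, ← hΦ]
    rfl

end FunctionModule

/-! ### Characters, boundaries and module maps -/

namespace FunctionModule

variable {Ω₁ Ω₂ : Type*} [TopologicalSpace Ω₁] [TopologicalSpace Ω₂]
  {A : Subalgebra ℂ C(Ω₁, ℂ)} {B : Subalgebra ℂ C(Ω₂, ℂ)}

theorem continuous_evalChar (A : Subalgebra ℂ C(Ω₁, ℂ)) : Continuous (evalChar A) :=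
  continuous_induced_rng.2 (WeakDual.continuous_of_continuous_eval fun a =>
    (a : C(Ω₁, ℂ)).continuous)

theorem evalChar_apply (A : Subalgebra ℂ C(Ω₁, ℂ)) (x : Ω₁) (a : A) :
    evalChar A x a = (a : C(Ω₁, ℂ)) x :=
  rfl

theorem characterSpace_apply_one (χ : WeakDual.characterSpace ℂ A) : χ 1 = 1 :=
  map_one χ

/-- The character of `A` obtained by composing a continuous isomorphism of `A` onto `B` with the
evaluation at a point. -/
noncomputable def pullbackChar (Φ : A ≃ₐ[ℂ] B) (hΦ : Continuous Φ) (x : Ω₂) :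
    WeakDual.characterSpace ℂ A :=
  ⟨(⟨{ toFun := fun a => (Φ a : C(Ω₂, ℂ)) x
       map_add' := fun a b => by rw [map_add]; rfl
       map_smul' := fun c a => by rw [map_smul]; rfl },
      (ContinuousEvalConst.continuous_eval_const x).comp (continuous_subtype_val.comp hΦ)⟩ :
        A →L[ℂ] ℂ), by
    constructor
    · intro h
      have h1 : (Φ 1 : C(Ω₂, ℂ)) x = 0 := DFunLike.congr_fun h (1 : A)
      rw [map_one] at h1
      exact one_ne_zero (α := ℂ) h1
    · intro a b
      change (Φ (a * b) : C(Ω₂, ℂ)) x = (Φ a : C(Ω₂, ℂ)) x * (Φ b : C(Ω₂, ℂ)) x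
      rw [map_mul]
      rfl⟩

theorem pullbackChar_apply (Φ : A ≃ₐ[ℂ] B) (hΦ : Continuous Φ) (x : Ω₂) (a : A) :
    pullbackChar Φ hΦ x a = (Φ a : C(Ω₂, ℂ)) x :=
  rfl

theorem continuous_pullbackChar (Φ : A ≃ₐ[ℂ] B) (hΦ : Continuous Φ) :
    Continuous (pullbackChar Φ hΦ) :=
  continuous_induced_rng.2 (WeakDual.continuous_of_continuous_eval fun a =>
    (Φ a : C(Ω₂, ℂ)).continuous)

theorem pullbackChar_injective (hB : B.SeparatesPoints) (Φ : A ≃ₐ[ℂ] B) (hΦ : Continuous Φ) :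
    Function.Injective (pullbackChar Φ hΦ) := by
  intro x y hxy
  by_contra hne
  obtain ⟨_, ⟨b, hb, rfl⟩, hbxy⟩ := hB hne
  have h := DFunLike.congr_fun hxy (Φ.symm ⟨b, hb⟩)
  rw [pullbackChar_apply, pullbackChar_apply, Φ.apply_symm_apply] at h
  exact hbxy h

theorem pullbackChar_eq_evalChar_iff (Φ : A ≃ₐ[ℂ] B) (hΦ : Continuous Φ) {x : Ω₂} {y : Ω₁} :
    pullbackChar Φ hΦ x = evalChar A y ↔
      ∀ a, (Φ a : C(Ω₂, ℂ)) x = (a : C(Ω₁, ℂ)) y :=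
  ⟨fun h a => DFunLike.congr_fun h a, fun h => DFunLike.ext _ _ h⟩

variable [CompactSpace Ω₁] [CompactSpace Ω₂]

/-- The unimodular factor is `1` because `Φ 1 = 1`. -/
theorem exists_choquetBoundary_of_algEquiv (Φ : A ≃ₐ[ℂ] B) (hΦ : ∀ a, ‖Φ a‖ = ‖a‖) {x : Ω₂}
    (hx : x ∈ choquetBoundary (Subalgebra.toSubmodule B)) :
    ∃ y ∈ choquetBoundary (Subalgebra.toSubmodule A),
      ∀ a, (Φ a : C(Ω₂, ℂ)) x = (a : C(Ω₁, ℂ)) y := by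
  have := nonempty_of_linearEquiv Φ.toLinearEquiv x
  let T : Subalgebra.toSubmodule A ≃ₗᵢ[ℂ] Subalgebra.toSubmodule B :=
    { A.toSubmoduleEquiv.trans (Φ.toLinearEquiv.trans B.toSubmoduleEquiv.symm) with
      norm_map' := fun a => hΦ ⟨a, a.2⟩ }
  obtain ⟨α, -, y, hy, h⟩ := exists_choquetBoundary_of_linearIsometryEquiv T hx
  have h' : ∀ a : A, (Φ a : C(Ω₂, ℂ)) x = α * (a : C(Ω₁, ℂ)) y := fun a => h ⟨a, a.2⟩
  have h1 : 1 = α * 1 := by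
    have := h' 1
    rwa [map_one] at this
  refine ⟨y, hy, fun a => ?_⟩
  rw [h', ← mul_one α, ← h1, one_mul]

theorem image_shilovBoundary_eq (Φ : A ≃ₐ[ℂ] B) (hΦ : Continuous Φ) (hn : ∀ a, ‖Φ a‖ = ‖a‖) :
    pullbackChar Φ hΦ '' shilovBoundary (Subalgebra.toSubmodule B) =
      evalChar A '' shilovBoundary (Subalgebra.toSubmodule A) := by
  have hsymm : ∀ b, ‖Φ.symm b‖ = ‖b‖ := fun b => by rw [← hn, Φ.apply_symm_apply]
  have hch : pullbackChar Φ hΦ '' choquetBoundary (Subalgebra.toSubmodule B) =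
      evalChar A '' choquetBoundary (Subalgebra.toSubmodule A) := by
    apply Subset.antisymm
    · rintro _ ⟨x, hx, rfl⟩
      obtain ⟨y, hy, h⟩ := exists_choquetBoundary_of_algEquiv Φ hn hx
      exact ⟨y, hy, ((pullbackChar_eq_evalChar_iff Φ hΦ).2 h).symm⟩
    · rintro _ ⟨y, hy, rfl⟩
      obtain ⟨x, hx, h⟩ := exists_choquetBoundary_of_algEquiv Φ.symm hsymm hy
      refine ⟨x, hx, (pullbackChar_eq_evalChar_iff Φ hΦ).2 fun a => ?_⟩
      rw [← h, Φ.symm_apply_apply]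
  have hc := continuous_pullbackChar Φ hΦ
  have hc' := continuous_evalChar A
  -- Both maps go from a compact space to a Hausdorff one, so images commute with closures.
  rw [shilovBoundary, shilovBoundary, ← hc.isClosedMap.closure_image_eq_of_continuous hc,
    ← hc'.isClosedMap.closure_image_eq_of_continuous hc', hch]

/-- At Choquet points `a = 1` gives `h(x) f₂(x) = α f₁(y)`; cancelling it identifies `φ x`, and
taking moduli gives the ratio. Pairs `(x, y)` so related form a closed set, whose projection along
the compact `Ω₁` is closed. -/
theorem exists_evalChar_eq_of_mem_shilovBoundary {f₁ : C(Ω₁, ℝ)} {f₂ : C(Ω₂, ℝ)}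
    (hf₁ : ∀ x, 0 < f₁ x) (hf₂ : ∀ x, 0 < f₂ x) (T : weighted A f₁ ≃ₗᵢ[ℂ] weighted B f₂) {h : B}
    {φ : Ω₂ → WeakDual.characterSpace ℂ A} (hφ : Continuous φ)
    (hT : ∀ a x, (T (weightedMk A f₁ a) : C(Ω₂, ℂ)) x =
      φ x a * (h : C(Ω₂, ℂ)) x * (f₂ x : ℂ))
    {x : Ω₂} (hx : x ∈ shilovBoundary (weighted B f₂)) :
    ∃ y, φ x = evalChar A y ∧ f₁ y / f₂ x = ‖(h : C(Ω₂, ℂ)) x‖ := by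
  let S : Set (Ω₂ × Ω₁) :=
    {p | φ p.1 = evalChar A p.2 ∧ f₁ p.2 / f₂ p.1 = ‖(h : C(Ω₂, ℂ)) p.1‖}
  have hS : IsClosed S := by
    refine (isClosed_eq (hφ.comp continuous_fst)
      ((continuous_evalChar A).comp continuous_snd)).inter (isClosed_eq ?_ ?_)
    · exact (f₁.continuous.comp continuous_snd).div (f₂.continuous.comp continuous_fst)
        fun p => (hf₂ p.1).ne'
    · exact ((h : C(Ω₂, ℂ)).continuous.comp continuous_fst).norm
  have hsub : choquetBoundary (weighted B f₂) ⊆ Prod.fst '' S := by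
    intro x hx
    have := nonempty_of_linearEquiv (coefficientEquiv hf₁ hf₂ T) x
    obtain ⟨α, hα, y, -, hy⟩ := exists_choquetBoundary_of_linearIsometryEquiv T hx
    have key : ∀ a : A, φ x a * (h : C(Ω₂, ℂ)) x * (f₂ x : ℂ) =
        α * ((a : C(Ω₁, ℂ)) y * (f₁ y : ℂ)) := fun a => by rw [← hT, hy, weightedMk_apply]
    have h1 : (h : C(Ω₂, ℂ)) x * (f₂ x : ℂ) = α * (f₁ y : ℂ) := by
      have h1 := key 1
      rw [characterSpace_apply_one, one_mul] at h1
      exact h1.trans (congrArg (α * ·) (one_mul _))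
    have hα0 : α ≠ 0 := by
      rintro rfl
      simp at hα
    have hy0 : (f₁ y : ℂ) ≠ 0 := Complex.ofReal_ne_zero.2 (hf₁ y).ne'
    refine ⟨(x, y), ⟨DFunLike.ext _ _ fun a => ?_, ?_⟩, rfl⟩
    · apply mul_right_cancel₀ (mul_ne_zero hα0 hy0)
      rw [evalChar_apply]
      linear_combination key a - φ x a * h1
    · have h2 := congrArg norm h1
      rw [norm_mul, norm_mul, hα, one_mul, Complex.norm_real, Complex.norm_real,
        Real.norm_of_nonneg (hf₂ x).le, Real.norm_of_nonneg (hf₁ y).le] at h2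
      rw [div_eq_iff (hf₂ x).ne', h2]
  obtain ⟨⟨x', y⟩, hxy, rfl⟩ := closure_minimal hsub (isClosedMap_fst_of_compactSpace S hS) hx
  exact ⟨y, hxy⟩

theorem map_weightedSMul_iff_eq_evalChar {A : Subalgebra ℂ C(Ω₁, ℂ)} {f₁ f₂ : C(Ω₁, ℝ)}
    (hf₂ : ∀ x, 0 < f₂ x) (T : weighted A f₁ →ₗᵢ[ℂ] weighted A f₂)
    (hTs : Function.Surjective T) (h : A) (φ : Ω₁ → WeakDual.characterSpace ℂ A)
    (hT : ∀ (a : A) (x : Ω₁), (T (weightedMk A f₁ a) : C(Ω₁, ℂ)) x =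
      φ x a * (h : C(Ω₁, ℂ)) x * (f₂ x : ℂ)) :
    (∀ (a : A) (g : weighted A f₁), T (weightedSMul A f₁ a g) = weightedSMul A f₂ a (T g)) ↔
      φ = evalChar A := by
  have hmk : ∀ a b : A, weightedSMul A f₁ a (weightedMk A f₁ b) = weightedMk A f₁ (a * b) :=
    fun a b => Subtype.ext (mul_assoc (a : C(Ω₁, ℂ)) b (toComplex f₁)).symm
  have hsm : ∀ (a : A) (g : weighted A f₂) (x : Ω₁),
      (weightedSMul A f₂ a g : C(Ω₁, ℂ)) x = (a : C(Ω₁, ℂ)) x * (g : C(Ω₁, ℂ)) x :=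
    fun _ _ _ => rfl
  constructor
  · intro hmod
    funext x
    refine DFunLike.ext _ _ fun a => ?_
    -- Otherwise every function in the range of `T` would vanish at `x`, but `f₂` is in the range.
    have hx0 : (h : C(Ω₁, ℂ)) x * (f₂ x : ℂ) ≠ 0 := by
      intro h0
      obtain ⟨g, hg⟩ := hTs (weightedMk A f₂ 1)
      obtain ⟨b, rfl⟩ := weightedMk_surjective A g
      have h1 := hT b x
      rw [mul_assoc, h0, mul_zero, hg, weightedMk_apply] at h1
      exact mul_ne_zero one_ne_zero (Complex.ofReal_ne_zero.2 (hf₂ x).ne') h1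
    have h1 := congrArg (fun g : weighted A f₂ => (g : C(Ω₁, ℂ)) x) (hmod a (weightedMk A f₁ 1))
    simp only [hmk, hsm, hT, mul_one, characterSpace_apply_one, one_mul] at h1
    apply mul_right_cancel₀ hx0
    rw [← mul_assoc, h1, evalChar_apply]
  · rintro rfl a g
    obtain ⟨b, rfl⟩ := weightedMk_surjective A g
    refine Subtype.ext (ContinuousMap.ext fun x => ?_)
    rw [hmk, hsm, hT, hT, map_mul, evalChar_apply]
    ring

end FunctionModule

theorem mainTheorem1 :
    (∀ (Ω₁ : Type u) (Ω₂ : Type v)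
        [TopologicalSpace Ω₁] [CompactSpace Ω₁] [T2Space Ω₁]
        [TopologicalSpace Ω₂] [CompactSpace Ω₂] [T2Space Ω₂]
        (A : Subalgebra ℂ C(Ω₁, ℂ)) (B : Subalgebra ℂ C(Ω₂, ℂ))
        (_ : A.SeparatesPoints) (_ : B.SeparatesPoints)
        (f₁ : C(Ω₁, ℝ)) (f₂ : C(Ω₂, ℝ)) (_ : ∀ x, 0 < f₁ x) (_ : ∀ x, 0 < f₂ x)
        (T : FunctionModule.weighted A f₁ →ₗᵢ[ℂ] FunctionModule.weighted B f₂)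
        (_ : Function.Surjective T),
      ∃ (h : B) (φ : Ω₂ → WeakDual.characterSpace ℂ A),
        IsUnit h ∧
        Topology.IsEmbedding φ ∧
        (∃ Φ : A ≃ₐ[ℂ] B, Isometry Φ ∧ ∀ (a : A) (x : Ω₂), (Φ a : C(Ω₂, ℂ)) x = φ x a) ∧
        φ '' FunctionModule.shilovBoundary (Subalgebra.toSubmodule B) =
          FunctionModule.evalChar A ''
            FunctionModule.shilovBoundary (Subalgebra.toSubmodule A) ∧
        (∀ x ∈ FunctionModule.shilovBoundary (FunctionModule.weighted B f₂),
          ∃ y : Ω₁, φ x = FunctionModule.evalChar A y ∧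
            f₁ y / f₂ x = ‖(h : C(Ω₂, ℂ)) x‖) ∧
        ∀ (a : A) (x : Ω₂),
          (T (FunctionModule.weightedMk A f₁ a) : C(Ω₂, ℂ)) x =
            φ x a * (h : C(Ω₂, ℂ)) x * (f₂ x : ℂ)) ∧
    (∀ (Ω : Type w) [TopologicalSpace Ω] [CompactSpace Ω] [T2Space Ω]
        (A : Subalgebra ℂ C(Ω, ℂ)) (_ : A.SeparatesPoints)
        (f₁ f₂ : C(Ω, ℝ)) (_ : ∀ x, 0 < f₁ x) (_ : ∀ x, 0 < f₂ x)
        (T : FunctionModule.weighted A f₁ →ₗᵢ[ℂ] FunctionModule.weighted A f₂)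
        (_ : Function.Surjective T)
        (h : A) (φ : Ω → WeakDual.characterSpace ℂ A)
        (_ : ∀ (a : A) (x : Ω),
          (T (FunctionModule.weightedMk A f₁ a) : C(Ω, ℂ)) x =
            φ x a * (h : C(Ω, ℂ)) x * (f₂ x : ℂ)),
      (∀ (a : A) (g : FunctionModule.weighted A f₁),
          T (FunctionModule.weightedSMul A f₁ a g) =
            FunctionModule.weightedSMul A f₂ a (T g)) ↔
        φ = FunctionModule.evalChar A) := by
  refine ⟨?_, ?_⟩
  · intro Ω₁ Ω₂ _ _ _ _ _ _ A B _ hB f₁ f₂ hf₁ hf₂ T hT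
    obtain ⟨h, Φ, hh, hn, hΦT⟩ := FunctionModule.exists_algEquiv_of_linearIsometryEquiv hf₁ hf₂
      (LinearIsometryEquiv.ofSurjective T hT)
    have hiso : Isometry Φ := AddMonoidHomClass.isometry_of_norm Φ hn
    have hΦ : Continuous Φ := hiso.continuous
    have hφ := FunctionModule.continuous_pullbackChar Φ hΦ
    exact ⟨h, FunctionModule.pullbackChar Φ hΦ, hh,
      (hφ.isClosedEmbedding (FunctionModule.pullbackChar_injective hB Φ hΦ)).isEmbedding,
      ⟨Φ, hiso, fun _ _ => rfl⟩, FunctionModule.image_shilovBoundary_eq Φ hΦ hn,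
      fun x hx => FunctionModule.exists_evalChar_eq_of_mem_shilovBoundary hf₁ hf₂
        (LinearIsometryEquiv.ofSurjective T hT) hφ hΦT hx, hΦT⟩
  · intro Ω _ _ _ A _ f₁ f₂ _ hf₂ T hT h φ hTφ
    exact FunctionModule.map_weightedSMul_iff_eq_evalChar hf₂ T hT h φ hTφ
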